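/- Theorem. Consider the $n\times n\times n$ Rubik's Cube: its cubies sit at the positions $(x,y,z)\in\{0,\dots,n-1\}^3$, a slice is the set of cubies sharing the value of one coordinate, and a move rotates one slice by $90^\circ$, in either direction, about the axis perpendicular to it. A configuration assigns one of six colors to each visible face of each cubie; it is solved if each of the six sides of the cube has a single color and different sides have different colors; it is reachable if it can be obtained from a solved configuration by a finite sequence of moves. Then every reachable configuration of the $n\times n\times n$ Rubik's Cube can be solved in $O(n^2/\log n)$ moves; that is, there is a constant $C>0$ such that for every integer $n\ge 2$ and every reachable configuration of the $n\times n\times n$ cube there is a sequence of at most $C\,n^2/\log n$ moves which transforms it into a solved configuration. -/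

import Mathlib

namespace RubiksCube

/-- One of the six outward directions (equivalently, sides of the big cube): a coordinate axis
together with a sign, `true` being the positive direction and `false` the negative one. -/
abbrev Face : Type := Fin 3 × Bool

/-- The six colors. -/
abbrev Color : Type := Fin 6

/-- The position of a cubie in the `n × n × n` cube. -/
abbrev Position (n : ℕ) : Type := Fin 3 → Fin n

/-- The side of the cubie at `p` that points in direction `f` is visible: it lies on the surface
of the big cube. -/
def Visible {n : ℕ} (p : Position n) (f : Face) : Prop :=
  if f.2 then (p f.1 : ℕ) + 1 = n else (p f.1 : ℕ) = 0

/-- A visible face of a cubie, given by the location of the cubie and the outward direction. -/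
@[ext]
structure Facelet (n : ℕ) where
  pos : Position n
  face : Face
  visible : Visible pos face

/-- Quarter turn about axis `a` on positions: in coordinates centred at the centre of the cube,
`(x_a, x_{a+1}, x_{a+2}) ↦ (x_a, -x_{a+2}, x_{a+1})`. -/
def rotPos {n : ℕ} (a : Fin 3) (p : Position n) : Position n := fun j =>
  if j = a then p a else if j = a + 1 then Fin.rev (p (a + 2)) else p (a + 1)

/-- The inverse of `rotPos`. -/
def unrotPos {n : ℕ} (a : Fin 3) (p : Position n) : Position n := fun j =>
  if j = a then p a else if j = a + 1 then p (a + 2) else Fin.rev (p (a + 1))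

/-- Quarter turn about axis `a` on directions, the linear part of `rotPos`. -/
def rotFace (a : Fin 3) (f : Face) : Face :=
  if f.1 = a then f else if f.1 = a + 1 then (a + 2, f.2) else (a + 1, !f.2)

/-- The inverse of `rotFace`. -/
def unrotFace (a : Fin 3) (f : Face) : Face :=
  if f.1 = a then f else if f.1 = a + 1 then (a + 2, !f.2) else (a + 1, f.2)

theorem unrotPos_rotPos {n : ℕ} (a : Fin 3) (p : Position n) : unrotPos a (rotPos a p) = p := by
  funext j
  fin_cases a <;> fin_cases j <;> simp [unrotPos, rotPos]

theorem rotPos_unrotPos {n : ℕ} (a : Fin 3) (p : Position n) : rotPos a (unrotPos a p) = p := by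
  funext j
  fin_cases a <;> fin_cases j <;> simp [unrotPos, rotPos]

theorem unrotFace_rotFace (a : Fin 3) (f : Face) : unrotFace a (rotFace a f) = f := by
  revert a f; decide

theorem rotFace_unrotFace (a : Fin 3) (f : Face) : rotFace a (unrotFace a f) = f := by
  revert a f; decide

theorem visible_rot {n : ℕ} (a : Fin 3) (p : Position n) (f : Face) (h : Visible p f) :
    Visible (rotPos a p) (rotFace a f) := by
  obtain ⟨j, s⟩ := f
  fin_cases a <;> fin_cases j <;> cases s <;>
    simp [Visible, rotPos, rotFace, Fin.val_rev] at h ⊢ <;> omega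

theorem visible_unrot {n : ℕ} (a : Fin 3) (p : Position n) (f : Face) (h : Visible p f) :
    Visible (unrotPos a p) (unrotFace a f) := by
  obtain ⟨j, s⟩ := f
  fin_cases a <;> fin_cases j <;> cases s <;>
    simp [Visible, unrotPos, unrotFace, Fin.val_rev] at h ⊢ <;> omega

/-- The quarter turn of the whole cube about axis `a`, as a permutation of the facelets. -/
def rot {n : ℕ} (a : Fin 3) : Equiv.Perm (Facelet n) where
  toFun s := ⟨rotPos a s.pos, rotFace a s.face, visible_rot a _ _ s.visible⟩
  invFun s := ⟨unrotPos a s.pos, unrotFace a s.face, visible_unrot a _ _ s.visible⟩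
  left_inv _ := Facelet.ext (unrotPos_rotPos a _) (unrotFace_rotFace a _)
  right_inv _ := Facelet.ext (rotPos_unrotPos a _) (rotFace_unrotFace a _)

theorem rot_pos_axis {n : ℕ} (a : Fin 3) (s : Facelet n) : (rot a s).pos a = s.pos a := by
  simp [rot, rotPos]

theorem rot_symm_pos_axis {n : ℕ} (a : Fin 3) (s : Facelet n) :
    ((rot a).symm s).pos a = s.pos a := by
  simp [rot, unrotPos]

/-- The quarter turn about axis `a` of the single slice of cubies whose `a`-coordinate is `i`;
all facelets of other cubies stay in place. -/
def sliceTurn {n : ℕ} (a : Fin 3) (i : Fin n) : Equiv.Perm (Facelet n) where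
  toFun s := if s.pos a = i then rot a s else s
  invFun s := if s.pos a = i then (rot a).symm s else s
  left_inv s := by
    by_cases h : s.pos a = i
    · simp [h, rot_pos_axis]
    · simp [h]
  right_inv s := by
    by_cases h : s.pos a = i
    · simp [h, rot_symm_pos_axis]
    · simp [h]

/-- A move of the `n × n × n` cube (`2 ≤ n`): turn the slice with coordinate `index` along `axis`
by 90 degrees, in the positive direction if `positive` is `true`, in the other one if not. -/
structure Move (n : ℕ) where
  axis : Fin 3
  index : Fin n
  positive : Bool

/-- Where a move carries each facelet. -/
def Move.perm {n : ℕ} (m : Move n) : Equiv.Perm (Facelet n) :=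
  if m.positive then sliceTurn m.axis m.index else (sliceTurn m.axis m.index).symm

/-- A configuration assigns a color to each visible face of each cubie. -/
abbrev Configuration (n : ℕ) : Type := Facelet n → Color

/-- The configuration after a move: the color seen at a location is the one that the move has
carried there. -/
def Configuration.move {n : ℕ} (c : Configuration n) (m : Move n) : Configuration n :=
  fun s => c (m.perm.symm s)

/-- The configuration after the moves of a list, performed from left to right. -/
def Configuration.moves {n : ℕ} (c : Configuration n) (l : List (Move n)) : Configuration n :=
  l.foldl Configuration.move c

/-- Each side of the big cube is of a single color, and different sides have different colors. -/
def Configuration.IsSolved {n : ℕ} (c : Configuration n) : Prop :=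
  ∃ col : Face → Color, Function.Injective col ∧ ∀ s : Facelet n, c s = col s.face

/-- The configuration can be reached from a solved one by a sequence of moves. -/
def Configuration.IsReachable {n : ℕ} (c : Configuration n) : Prop :=
  ∃ c₀ : Configuration n, c₀.IsSolved ∧ ∃ l : List (Move n), c₀.moves l = c

end RubiksCube

/-!
The rotations of the whole cube divide the facelets into orbits of at most 24, one for each cell of
a quarter of a side. A commutator of turns of the slices with index in `I` and of conjugates of
turns of the slices with index in `J` acts as the same three-cycle on the orbits of all cells in
`I × J` and trivially elsewhere, so `O(|I| + |J|)` moves treat `|I| * |J|` orbits at once. To treat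
an arbitrary set of cells, cut the columns into blocks of `b`. Within a block, the rows with the
same pattern form a rectangle, and there are at most `2 ^ b` patterns, whence `O(n + b * 2 ^ b)`
moves for a block and `O(n / b * (n + b * 2 ^ b))` for the whole set. This is `O(n ^ 2 / log n)` for
`b ~ log₂ n / 2`.

Rotating the cube before and after such a process conjugates the three-cycle; the conjugates
generate the alternating group of an orbit, with words of bounded length. An odd permutation of the
orbit of a border cell is first made even by a single turn; elsewhere it is corrected up to an
exchange of two facelets of the same color. The orbits of the corners, the middles of the edges and
the centres of the sides are bounded in number, so that boundedly many moves restore them first.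
-/

section Group

open Pointwise

theorem exists_mem_pow_of_mem_closure {G : Type*} [Group G] [Finite G] {S : Set G} {g : G}
    (hg : g ∈ Subgroup.closure S) : ∃ k, g ∈ S ^ k := by
  rw [← Subgroup.mem_toSubmonoid, Subgroup.closure_toSubmonoid_of_finite] at hg
  induction hg using Submonoid.closure_induction with
  | mem x hx => exact ⟨1, by rwa [pow_one]⟩
  | one => exact ⟨0, Set.one_mem_one⟩
  | mul x y _ _ hx hy =>
    obtain ⟨j, hj⟩ := hx
    obtain ⟨k, hk⟩ := hy
    exact ⟨j + k, pow_add S j k ▸ Set.mul_mem_mul hj hk⟩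

theorem exists_forall_closure_subset_pow (G : Type*) [Group G] [Finite G] :
    ∃ K, ∀ S : Set G, 1 ∈ S → (Subgroup.closure S : Set G) ⊆ S ^ K := by
  have h : ∀ (S : Set G) (g : G), ∃ k, 1 ∈ S → g ∈ Subgroup.closure S → g ∈ S ^ k := fun S g => by
    by_cases hg : 1 ∈ S ∧ g ∈ Subgroup.closure S
    · exact (exists_mem_pow_of_mem_closure hg.2).imp fun _ hk _ _ => hk
    · exact ⟨0, fun h₁ h₂ => (hg ⟨h₁, h₂⟩).elim⟩
  choose k hk using h
  obtain ⟨K, hK⟩ := (Set.finite_range k.uncurry).bddAbove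
  exact ⟨K, fun S hS g hg =>
    Set.pow_subset_pow_right hS (hK ⟨(S, g), rfl⟩) (hk S g hS hg)⟩

universe u in
/-- Only the values in the finite group `Γ` matter for the number of factors needed to correct
`g`, so the bound is uniform in `G`, `S` and `g`. -/
theorem exists_forall_exists_mem_pow_one_mem (Γ : Type*) [Group Γ] [Finite Γ] :
    ∃ K, ∀ {G : Type u} [Group G] (R : Subgroup (Γ × G)) (S : Set G), 1 ∈ S →
      (∀ s ∈ S, ∃ γ, (γ, s) ∈ R) → ∀ g ∈ Subgroup.closure S, ∃ w ∈ S ^ K, (1, w * g) ∈ R := by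
  obtain ⟨K, hK⟩ := exists_forall_closure_subset_pow Γ
  refine ⟨K, fun {G} _ R S hS hR g hg => ?_⟩
  let P : Set (Γ × G) := {p ∈ (R : Set (Γ × G)) | p.2 ∈ S}
  have hPR : Subgroup.closure P ≤ R := (Subgroup.closure_le R).2 fun p hp => hp.1
  have hsnd : MonoidHom.snd Γ G '' P = S :=
    (Set.image_subset_iff.2 fun p hp => hp.2).antisymm fun s hs =>
      let ⟨γ, hγ⟩ := hR s hs
      ⟨(γ, s), ⟨hγ, hs⟩, rfl⟩
  rw [← hsnd, ← MonoidHom.map_closure] at hg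
  obtain ⟨p, hp, rfl⟩ := hg
  have hinv : p.1⁻¹ ∈ (MonoidHom.fst Γ G '' P) ^ K := by
    refine hK (MonoidHom.fst Γ G '' P) ⟨1, ⟨one_mem R, hS⟩, map_one _⟩ ?_
    rw [← MonoidHom.map_closure]
    exact ⟨p⁻¹, inv_mem hp, rfl⟩
  rw [← Set.image_pow] at hinv
  obtain ⟨q, hq, hqp⟩ := hinv
  refine ⟨q.2, ?_, ?_⟩
  · rw [← hsnd, ← Set.image_pow]
    exact ⟨q, hq, rfl⟩
  · have hmem : q * p ∈ R := mul_mem (hPR (Subgroup.pow_subset Subgroup.subset_closure hq)) (hPR hp)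
    have hone : q.1 * p.1 = 1 := by rw [show q.1 = p.1⁻¹ from hqp, inv_mul_cancel]
    rwa [← hone]

end Group

section ThreeCycle

open Pointwise

variable {α : Type*} [Fintype α] [DecidableEq α]

theorem smul_set_eq_of_isThreeCycle {t : Equiv.Perm α} (ht : t.IsThreeCycle) {B : Set α}
    (hB : B.Nontrivial) (h : t • B = B ∨ Disjoint (t • B) B) : t • B = B := by
  refine h.resolve_right fun hdisj => ?_
  have hsupp : t • B ∪ B ⊆ (t.support : Set α) := by
    have hmoved : ∀ x ∈ B, t x ≠ x := fun x hx h =>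
      Set.disjoint_left.1 hdisj (Set.smul_mem_smul_set hx) (show t x ∈ B from h.symm ▸ hx)
    rintro _ (⟨x, hx, rfl⟩ | hx)
    · simpa using hmoved x hx
    · simpa using hmoved _ hx
  have hle := Set.ncard_le_ncard hsupp
  rw [Set.ncard_union_eq hdisj, Set.ncard_smul_set, Set.ncard_coe_finset, ht.card_support] at hle
  have := Set.one_lt_ncard_iff_nontrivial.2 hB
  omega

theorem alternatingGroup_le_closure_of_isThreeCycle {T : Set (Equiv.Perm α)}
    (hT : ∀ t ∈ T, t.IsThreeCycle) (hne : T.Nonempty)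
    (htrans : ∀ x y, ∃ g ∈ Subgroup.closure T, g x = y) :
    alternatingGroup α ≤ Subgroup.closure T := by
  obtain ⟨t₀, ht₀⟩ := hne
  have : MulAction.IsPretransitive (Subgroup.closure T) α :=
    ⟨fun x y => let ⟨g, hg, h⟩ := htrans x y; ⟨⟨g, hg⟩, h⟩⟩
  refine Equiv.Perm.alternatingGroup_le_of_isPreprimitive_of_isThreeCycle_mem
    (g := t₀) ⟨fun {B} hB => ?_⟩ (hT _ ht₀) (Subgroup.subset_closure ht₀)
  rw [MulAction.IsTrivialBlock, or_iff_not_imp_left, Set.not_subsingleton_iff]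
  intro hnontrivial
  have hstab : Subgroup.closure T ≤ MulAction.stabilizer (Equiv.Perm α) B :=
    (Subgroup.closure_le _).2 fun t ht => smul_set_eq_of_isThreeCycle (hT t ht) hnontrivial
      (MulAction.isBlock_iff_smul_eq_or_disjoint.1 hB ⟨t, Subgroup.subset_closure ht⟩)
  obtain ⟨x, hx⟩ := hnontrivial.nonempty
  refine Set.eq_univ_of_forall fun z => ?_
  obtain ⟨g, hg, rfl⟩ := htrans x z
  rw [← MulAction.mem_stabilizer_iff.1 (hstab hg)]
  exact Set.smul_mem_smul_set hx

end ThreeCycle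

namespace RubiksCube

/-- The 24 orientations of the cube, encoded as the facelets of a corner orbit: the axis of the
face, and for each coordinate axis whether the cubie lies on the far side. They index the images
of a facelet under the rotations of the whole cube. -/
abbrev Label : Type := Fin 3 × Bool × Bool × Bool

namespace Label

/-- The side (far or near) on which a label lies along an axis. -/
def sign (l : Label) (c : Fin 3) : Bool :=
  if c = 0 then l.2.1 else if c = 1 then l.2.2.1 else l.2.2.2

/-- The side of the cube on which a label lies. -/
def face (l : Label) : Face := (l.1, l.sign l.1)

/-- The label with a given face axis and given sides. -/
def mk (f : Fin 3) (e : Fin 3 → Bool) : Label := (f, e 0, e 1, e 2)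

/-- Which coordinate of the reference cell (`0`: the extreme one, `1`, `2`: the two coordinates
inside the face) appears along axis `c`. The two inner ones are exchanged by reflections, hence
the parity of the signs. -/
def sym (l : Label) (c : Fin 3) : Fin 3 :=
  if c = l.1 then 0
  else if decide (c = l.1 + 1) = xor (l.sign 0) (xor (l.sign 1) (l.sign 2)) then 1 else 2

/-- The map underlying `Label.rot`. -/
def rotFun (a : Fin 3) (l : Label) : Label :=
  mk (rotFace a l.face).1
    fun j => if j = a then l.sign a else if j = a + 1 then !l.sign (a + 2) else l.sign (a + 1)

/-- The inverse of `Label.rotFun`. -/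
def unrotFun (a : Fin 3) (l : Label) : Label :=
  mk (unrotFace a l.face).1
    fun j => if j = a then l.sign a else if j = a + 1 then l.sign (a + 2) else !l.sign (a + 1)

/-- The quarter turn of the whole cube about axis `a`, on labels. -/
def rot (a : Fin 3) : Equiv.Perm Label where
  toFun := rotFun a
  invFun := unrotFun a
  left_inv := by revert a; decide
  right_inv := by revert a; decide

theorem sign_rot (a : Fin 3) (l : Label) : (rot a l).sign a = l.sign a := by
  revert a l; decide

theorem sign_rot_symm (a : Fin 3) (l : Label) : ((rot a).symm l).sign a = l.sign a := by
  revert a l; decide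

theorem sym_rot (a : Fin 3) (l : Label) : (rot a l).sym a = l.sym a := by
  revert a l; decide

theorem sym_rot_symm (a : Fin 3) (l : Label) : ((rot a).symm l).sym a = l.sym a := by
  revert a l; decide

/-- The simultaneous turn of slices perpendicular to axis `a`, on labels: `m s b` tells whether
the slice which holds the reference coordinate `s` on side `b` is turned. -/
def turn (a : Fin 3) (m : Fin 3 → Bool → Bool) : Equiv.Perm Label where
  toFun l := if m (l.sym a) (l.sign a) then rot a l else l
  invFun l := if m (l.sym a) (l.sign a) then (rot a).symm l else l
  left_inv l := by by_cases h : m (l.sym a) (l.sign a) <;> simp [h, sym_rot, sign_rot]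
  right_inv l := by by_cases h : m (l.sym a) (l.sign a) <;> simp [h, sym_rot_symm, sign_rot_symm]

theorem turn_false (a : Fin 3) : turn a (fun _ _ => false) = 1 := rfl

theorem sign_turn_near (p : Bool) :
    Equiv.Perm.sign (turn 0 fun s b => ![false, p, false] s && !b) = if p then -1 else 1 := by
  have hfalse : (turn 0 fun s b => ![false, false, false] s && !b) = 1 := by decide
  have htrue : (turn 0 fun s b => ![false, true, false] s && !b) =
      Equiv.swap (2, false, false, true) (1, false, false, false) *
        Equiv.swap (1, false, false, false) (2, false, true, false) *
          Equiv.swap (2, false, true, false) (1, false, true, true) := by decide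
  cases p
  · rw [hfalse, map_one]; rfl
  · rw [htrue, map_mul, map_mul, Equiv.Perm.sign_swap (by decide),
      Equiv.Perm.sign_swap (by decide), Equiv.Perm.sign_swap (by decide)]
    rfl

/-- The three-cycle by which the commutators `cellComm` act on an orbit. -/
def cycle : Equiv.Perm Label :=
  Equiv.swap (2, false, false, true) (1, false, false, false) *
    Equiv.swap (1, false, false, false) (1, true, false, false)

theorem isThreeCycle_cycle : cycle.IsThreeCycle := by
  have h := Equiv.Perm.isThreeCycle_swap_mul_swap_same (α := Label)
    (a := (1, false, false, false)) (b := (2, false, false, true)) (c := (1, true, false, false))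
    (by decide) (by decide) (by decide)
  rwa [Equiv.swap_comm] at h

open scoped commutatorElement in
set_option synthInstance.maxSize 1000 in
/-- For the cell with inner coordinates `i`, `j`, the parameters stand for `i ∈ I` and `j ∈ I`
(`p₁`, `p₂`), `0 ∈ J`, `i ∈ J` and `j ∈ J` (`q₀`, `q₁`, `q₂`), `j = j.rev` (`m`) and `j = 0` (`z`)
in the commutator `cellComm I J` below. -/
theorem commutator_turn (p₁ p₂ q₀ q₁ q₂ m z : Bool) (hp : p₂ → !m && !z)
    (hz : z → !m && (q₂ == q₀)) :
    ⁅turn 0 fun s b => ![false, p₁, p₂] s && !b,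
      (turn 2 fun s b => ![true, false, z] s && b)⁻¹ *
        (turn 0 fun s b => ![q₀, q₁, q₂] s && (b || ![false, false, m] s)) *
        turn 2 fun s b => ![true, false, z] s && b⁆ =
      if p₁ && q₂ then cycle else 1 := by
  revert p₁ p₂ q₀ q₁ q₂ m z
  decide +kernel

/-- The conjugates of the basic three-cycle by rotations of the cube. -/
def cycles : Set (Equiv.Perm Label) :=
  {t | ∃ σ ∈ Subgroup.closure (Set.range rot), t = σ * cycle * σ⁻¹}

theorem cycle_mem_cycles : cycle ∈ cycles := ⟨1, one_mem _, by simp⟩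

theorem isThreeCycle_of_mem_cycles {t : Equiv.Perm Label} (ht : t ∈ cycles) :
    t.IsThreeCycle := by
  obtain ⟨σ, -, rfl⟩ := ht
  rw [Equiv.Perm.IsThreeCycle, Equiv.Perm.cycleType_conj]
  exact isThreeCycle_cycle

theorem rot_conj_mem_closure_cycles (a : Fin 3) {g : Equiv.Perm Label}
    (hg : g ∈ Subgroup.closure cycles) : rot a * g * (rot a)⁻¹ ∈ Subgroup.closure cycles := by
  induction hg using Subgroup.closure_induction with
  | mem x hx =>
    obtain ⟨τ, hτ, rfl⟩ := hx
    exact Subgroup.subset_closure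
      ⟨rot a * τ, mul_mem (Subgroup.subset_closure ⟨a, rfl⟩) hτ, by group⟩
  | one => simp
  | mul x y _ _ hx hy => simpa [mul_assoc] using mul_mem hx hy
  | inv x _ hx => simpa [mul_assoc] using inv_mem hx

theorem exists_mem_closure_cycles (l : Label) :
    ∃ g ∈ Subgroup.closure cycles, g (2, false, false, true) = l := by
  set base : Label := (2, false, false, true)
  let X : Set Label := {l | ∃ g ∈ Subgroup.closure cycles, g base = l}
  have rot_mem : ∀ a, rot a base ∈ X → ∀ (k : ℕ) (l), l ∈ X → (rot a ^ k) l ∈ X := by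
    rintro a ⟨h, hh, hbase⟩ k
    induction k with
    | zero => exact fun l hl => hl
    | succ k ih =>
      rintro _ ⟨g, hg, rfl⟩
      refine ih _ ⟨rot a * g * (rot a)⁻¹ * h, mul_mem (rot_conj_mem_closure_cycles a hg) hh, ?_⟩
      simp [hbase]
  have h0 : rot 0 base ∈ X := ⟨cycle, Subgroup.subset_closure cycle_mem_cycles, by decide⟩
  have h2 : rot 2 base ∈ X := ⟨(rot 0)⁻¹ * cycle * rot 0, Subgroup.subset_closure
    ⟨(rot 0)⁻¹, inv_mem (Subgroup.subset_closure ⟨0, rfl⟩), by simp⟩, by decide⟩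
  have hall : ∀ l, ∃ i j k : Fin 4,
      (rot 2 ^ (i : ℕ)) ((rot 0 ^ (j : ℕ)) ((rot 2 ^ (k : ℕ)) base)) = l := by
    decide +kernel
  obtain ⟨i, j, k, rfl⟩ := hall l
  exact rot_mem 2 h2 _ _ (rot_mem 0 h0 _ _ (rot_mem 2 h2 _ _ ⟨1, one_mem _, rfl⟩))

theorem closure_cycles : Subgroup.closure cycles = alternatingGroup Label := by
  refine le_antisymm ((Subgroup.closure_le _).2 fun t ht =>
    (isThreeCycle_of_mem_cycles ht).mem_alternatingGroup)
    (alternatingGroup_le_closure_of_isThreeCycle (fun t => isThreeCycle_of_mem_cycles)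
      ⟨cycle, cycle_mem_cycles⟩ fun x y => ?_)
  obtain ⟨g, hg, rfl⟩ := exists_mem_closure_cycles x
  obtain ⟨h, hh, rfl⟩ := exists_mem_closure_cycles y
  exact ⟨h * g⁻¹, mul_mem hh (inv_mem hg), by simp⟩

end Label

section Moves

open Pointwise

variable {n : ℕ}

/-- The moves together with the identity; the elements of `moveSet n ^ k` are the products of at
most `k` moves. -/
def moveSet (n : ℕ) : Set (Equiv.Perm (Facelet n)) := insert 1 (Set.range Move.perm)

theorem one_mem_moveSet : 1 ∈ moveSet n := Set.mem_insert _ _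

theorem perm_mem_moveSet (m : Move n) : m.perm ∈ moveSet n := Or.inr ⟨m, rfl⟩

theorem inv_perm (a : Fin 3) (i : Fin n) (b : Bool) :
    (Move.perm ⟨a, i, b⟩)⁻¹ = Move.perm ⟨a, i, !b⟩ := by
  cases b <;> rfl

theorem inv_mem_moveSet {g : Equiv.Perm (Facelet n)} (hg : g ∈ moveSet n) : g⁻¹ ∈ moveSet n := by
  obtain rfl | ⟨⟨a, i, b⟩, rfl⟩ := hg
  · simpa using one_mem_moveSet
  · rw [inv_perm]
    exact perm_mem_moveSet _

theorem inv_moveSet : (moveSet n)⁻¹ = moveSet n :=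
  Set.ext fun g => ⟨fun hg => inv_inv g ▸ inv_mem_moveSet hg, inv_mem_moveSet⟩

section Cost

variable {g h : Equiv.Perm (Facelet n)} {j k : ℕ}

theorem moveSet_pow_mono (hg : g ∈ moveSet n ^ j) (hjk : j ≤ k) : g ∈ moveSet n ^ k :=
  Set.pow_subset_pow_right one_mem_moveSet hjk hg

theorem one_mem_moveSet_pow : 1 ∈ moveSet n ^ k :=
  moveSet_pow_mono (pow_zero (moveSet n) ▸ Set.one_mem_one) k.zero_le

theorem mul_mem_moveSet_pow (hg : g ∈ moveSet n ^ j) (hh : h ∈ moveSet n ^ k) :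
    g * h ∈ moveSet n ^ (j + k) :=
  pow_add (moveSet n) j k ▸ Set.mul_mem_mul hg hh

theorem inv_mem_moveSet_pow (hg : g ∈ moveSet n ^ k) : g⁻¹ ∈ moveSet n ^ k := by
  rwa [← inv_moveSet, inv_pow, Set.inv_mem_inv]

open scoped commutatorElement in
theorem commutator_mem_moveSet_pow (hg : g ∈ moveSet n ^ j) (hh : h ∈ moveSet n ^ k) :
    ⁅g, h⁆ ∈ moveSet n ^ (2 * (j + k)) :=
  moveSet_pow_mono (mul_mem_moveSet_pow (mul_mem_moveSet_pow (mul_mem_moveSet_pow hg hh)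
    (inv_mem_moveSet_pow hg)) (inv_mem_moveSet_pow hh)) (by omega)

end Cost

theorem sliceTurn_apply (a : Fin 3) (i : Fin n) (s : Facelet n) :
    sliceTurn a i s = if s.pos a = i then rot a s else s := rfl

theorem sliceTurn_inv_apply (a : Fin 3) (i : Fin n) (s : Facelet n) :
    (sliceTurn a i)⁻¹ s = if s.pos a = i then (rot a)⁻¹ s else s := rfl

/-- The simultaneous turn of all slices perpendicular to `a` with index in `A`. -/
def turns (a : Fin 3) (A : Finset (Fin n)) : Equiv.Perm (Facelet n) where
  toFun s := if s.pos a ∈ A then rot a s else s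
  invFun s := if s.pos a ∈ A then (rot a).symm s else s
  left_inv s := by by_cases h : s.pos a ∈ A <;> simp [h, rot_pos_axis]
  right_inv s := by by_cases h : s.pos a ∈ A <;> simp [h, rot_symm_pos_axis]

theorem turns_apply (a : Fin 3) (A : Finset (Fin n)) (s : Facelet n) :
    turns a A s = if s.pos a ∈ A then rot a s else s := rfl

theorem turns_empty (a : Fin 3) : turns a (∅ : Finset (Fin n)) = 1 := by
  ext1 s; simp [turns_apply]

theorem turns_singleton (a : Fin 3) (i : Fin n) : turns a {i} = sliceTurn a i := by
  ext1 s; simp [turns_apply, sliceTurn_apply]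

theorem turns_insert (a : Fin 3) {i : Fin n} {A : Finset (Fin n)} (hi : i ∉ A) :
    turns a (insert i A) = sliceTurn a i * turns a A := by
  ext1 s
  rw [Equiv.Perm.mul_apply]
  simp only [turns_apply, sliceTurn_apply, Finset.mem_insert]
  by_cases h : s.pos a ∈ A
  · have : s.pos a ≠ i := fun h' => hi (h' ▸ h)
    simp [h, rot_pos_axis, this]
  · simp [h]

theorem turns_mem_moveSet_pow (a : Fin 3) (A : Finset (Fin n)) :
    turns a A ∈ moveSet n ^ A.card := by
  induction A using Finset.induction_on with
  | empty => simp [turns_empty]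
  | insert i A hi ih =>
    rw [turns_insert a hi, Finset.card_insert_of_notMem hi, pow_succ']
    exact Set.mul_mem_mul (perm_mem_moveSet ⟨a, i, true⟩) ih

/-- The group generated by the moves. -/
def cubeGroup (n : ℕ) : Subgroup (Equiv.Perm (Facelet n)) := Subgroup.closure (moveSet n)

theorem mem_cubeGroup_of_mem_moveSet_pow {g : Equiv.Perm (Facelet n)} {k : ℕ}
    (hg : g ∈ moveSet n ^ k) : g ∈ cubeGroup n :=
  Subgroup.pow_subset Subgroup.subset_closure hg

theorem pos_eq_pos_of_mem_moveSet {g : Equiv.Perm (Facelet n)} (hg : g ∈ moveSet n)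
    {s t : Facelet n} (h : s.pos = t.pos) : (g s).pos = (g t).pos := by
  obtain rfl | ⟨⟨a, i, _ | _⟩, rfl⟩ := hg
  · exact h
  · change ((sliceTurn a i)⁻¹ s).pos = ((sliceTurn a i)⁻¹ t).pos
    rw [sliceTurn_inv_apply, sliceTurn_inv_apply, h]
    split
    · exact congrArg (unrotPos a) h
    · exact h
  · change (sliceTurn a i s).pos = (sliceTurn a i t).pos
    rw [sliceTurn_apply, sliceTurn_apply, h]
    split
    · exact congrArg (rotPos a) h
    · exact h

theorem pos_eq_pos_of_mem_cubeGroup {g : Equiv.Perm (Facelet n)} (hg : g ∈ cubeGroup n)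
    {s t : Facelet n} (h : s.pos = t.pos) : (g s).pos = (g t).pos := by
  induction hg using Subgroup.closure_induction'' generalizing s t with
  | mem g hg => exact pos_eq_pos_of_mem_moveSet hg h
  | inv_mem g hg => exact pos_eq_pos_of_mem_moveSet (inv_mem_moveSet hg) h
  | one => exact h
  | mul _ _ _ _ h₁ h₂ => exact h₁ (h₂ h)

section Rotation

theorem rot_conj_sliceTurn_self (a : Fin 3) (i : Fin n) :
    rot a * sliceTurn a i * (rot a)⁻¹ = sliceTurn a i := by
  rw [mul_inv_eq_iff_eq_mul]
  ext1 s
  simp only [Equiv.Perm.mul_apply, sliceTurn_apply, rot_pos_axis]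
  split <;> rfl

theorem rot_pos_add_one (a : Fin 3) (s : Facelet n) :
    (rot a s).pos (a + 1) = (s.pos (a + 2)).rev := by
  fin_cases a <;> simp [rot, rotPos]

theorem rot_pos_add_two (a : Fin 3) (s : Facelet n) :
    (rot a s).pos (a + 2) = s.pos (a + 1) := by
  fin_cases a <;> simp [rot, rotPos]

theorem rot_mul_rot_add_one (a : Fin 3) :
    rot a * rot (a + 1) = rot (a + 2) * (rot a : Equiv.Perm (Facelet n)) := by
  ext1 ⟨p, ⟨f, e⟩, v⟩
  refine Facelet.ext ?_ ?_
  · funext j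
    fin_cases a <;> fin_cases j <;> simp [rot, rotPos]
  · simp only [rot, Equiv.Perm.mul_apply, Equiv.coe_fn_mk]
    clear v
    revert a f e
    decide

theorem rot_add_one_mul_rot_mul_rot_add_two (a : Fin 3) :
    rot (a + 1) * (rot a * rot (a + 2)) = (rot a : Equiv.Perm (Facelet n)) := by
  ext1 ⟨p, ⟨f, e⟩, v⟩
  refine Facelet.ext ?_ ?_
  · funext j
    fin_cases a <;> fin_cases j <;> simp [rot, rotPos]
  · simp only [rot, Equiv.Perm.mul_apply, Equiv.coe_fn_mk]
    clear v
    revert a f e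
    decide

theorem rot_conj_sliceTurn_add_one (a : Fin 3) (i : Fin n) :
    rot a * sliceTurn (a + 1) i * (rot a)⁻¹ = sliceTurn (a + 2) i := by
  rw [mul_inv_eq_iff_eq_mul]
  ext1 s
  simp only [Equiv.Perm.mul_apply, sliceTurn_apply, rot_pos_add_two]
  split
  · exact DFunLike.congr_fun (rot_mul_rot_add_one a) s
  · rfl

theorem rot_conj_sliceTurn_add_two (a : Fin 3) (i : Fin n) :
    rot a * sliceTurn (a + 2) i * (rot a)⁻¹ = (sliceTurn (a + 1) i.rev)⁻¹ := by
  rw [mul_inv_eq_iff_eq_mul]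
  ext1 s
  simp only [Equiv.Perm.mul_apply, sliceTurn_apply, sliceTurn_inv_apply, rot_pos_add_one,
    Fin.rev_inj]
  split
  · exact DFunLike.congr_fun (eq_inv_mul_of_mul_eq (rot_add_one_mul_rot_mul_rot_add_two a)) s
  · rfl

theorem rot_conj_sliceTurn_mem_moveSet (a b : Fin 3) (i : Fin n) :
    rot a * sliceTurn b i * (rot a)⁻¹ ∈ moveSet n := by
  obtain rfl | rfl | rfl : b = a ∨ b = a + 1 ∨ b = a + 2 := by revert a b; decide
  · rw [rot_conj_sliceTurn_self]
    exact perm_mem_moveSet ⟨b, i, true⟩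
  · rw [rot_conj_sliceTurn_add_one]
    exact perm_mem_moveSet ⟨a + 2, i, true⟩
  · rw [rot_conj_sliceTurn_add_two]
    exact perm_mem_moveSet ⟨a + 1, i.rev, false⟩

theorem rot_conj_mem_moveSet (a : Fin 3) {g : Equiv.Perm (Facelet n)} (hg : g ∈ moveSet n) :
    rot a * g * (rot a)⁻¹ ∈ moveSet n := by
  obtain rfl | ⟨⟨b, i, _ | _⟩, rfl⟩ := hg
  · simpa using one_mem_moveSet
  · change rot a * (sliceTurn b i)⁻¹ * (rot a)⁻¹ ∈ moveSet n
    simpa [mul_assoc] using inv_mem_moveSet (rot_conj_sliceTurn_mem_moveSet a b i)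
  · exact rot_conj_sliceTurn_mem_moveSet a b i

theorem rot_conj_mem_moveSet_pow (a : Fin 3) {g : Equiv.Perm (Facelet n)} {k : ℕ}
    (hg : g ∈ moveSet n ^ k) : rot a * g * (rot a)⁻¹ ∈ moveSet n ^ k := by
  have himage : MulAut.conj (rot a) '' moveSet n ⊆ moveSet n :=
    Set.image_subset_iff.2 fun _ => rot_conj_mem_moveSet a
  exact Set.pow_subset_pow_left himage (Set.image_pow (MulAut.conj (rot a)) _ k ▸ ⟨g, hg, rfl⟩)

end Rotation

end Moves

section Place

open Pointwise

variable {n : ℕ} [NeZero n] {ι : Type*}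

/-- The coordinate `s` (`0`: the extreme one, `1`, `2`: those of the cell `c`) on side `b`; the far
side is the reflection of the near one. -/
def coord (c : Fin n × Fin n) (s : Fin 3) (b : Bool) : Fin n :=
  if b then (![0, c.1, c.2] s).rev else ![0, c.1, c.2] s

/-- The facelet with label `l` in the orbit, under the rotations of the cube, of the cell of a side
with inner coordinates `c`. -/
def place (c : Fin n × Fin n) (l : Label) : Facelet n where
  pos a := coord c (l.sym a) (l.sign a)
  face := l.face
  visible := by
    have hsym : l.sym l.1 = 0 := by simp [Label.sym]
    have hn := Nat.pos_of_neZero n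
    simp only [Visible, Label.face, hsym, coord]
    cases l.sign l.1 <;> simp [Fin.val_rev]; omega

theorem place_pos (c : Fin n × Fin n) (l : Label) (a : Fin 3) :
    (place c l).pos a = coord c (l.sym a) (l.sign a) := rfl

theorem coord_not (c : Fin n × Fin n) (s : Fin 3) (b : Bool) :
    coord c s (!b) = (coord c s b).rev := by
  cases b <;> simp [coord]

theorem rot_place (a : Fin 3) (c : Fin n × Fin n) (l : Label) :
    rot a (place c l) = place c (Label.rot a l) := by
  have hface : ∀ (a : Fin 3) (l : Label), rotFace a l.face = (Label.rot a l).face := by decide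
  have hone : ∀ (a : Fin 3) (l : Label), (Label.rot a l).sym (a + 1) = l.sym (a + 2) ∧
      (Label.rot a l).sign (a + 1) = !l.sign (a + 2) := by decide
  have htwo : ∀ (a : Fin 3) (l : Label), (Label.rot a l).sym (a + 2) = l.sym (a + 1) ∧
      (Label.rot a l).sign (a + 2) = l.sign (a + 1) := by decide
  refine Facelet.ext (funext fun b => ?_) (hface a l)
  obtain rfl | rfl | rfl : b = a ∨ b = a + 1 ∨ b = a + 2 := by revert a b; decide
  · simp only [rot_pos_axis, place, Label.sym_rot, Label.sign_rot]
  · simp only [rot_pos_add_one, place, hone, coord_not]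
  · simp only [rot_pos_add_two, place, htwo]

/-- The pairs of a family of permutations of labels and a permutation of facelets that acts
according to it on the orbits of the given cells. -/
def realizers (cells : ι → Fin n × Fin n) :
    Subgroup ((ι → Equiv.Perm Label) × Equiv.Perm (Facelet n)) where
  carrier := {p | ∀ x l, p.2 (place (cells x) l) = place (cells x) (p.1 x l)}
  one_mem' _ _ := rfl
  mul_mem' hp hq x l := by
    change _ = place _ ((_ * _ : Equiv.Perm Label) l)
    rw [Prod.snd_mul, Equiv.Perm.mul_apply, hq, hp, Equiv.Perm.mul_apply]
  inv_mem' {p} hp x l := by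
    rw [Prod.snd_inv, Equiv.Perm.inv_eq_iff_eq, hp]
    simp

open scoped commutatorElement in
theorem commutator_mem_realizers {cells : ι → Fin n × Fin n} {α β : ι → Equiv.Perm Label}
    {g h : Equiv.Perm (Facelet n)} (hg : (α, g) ∈ realizers cells)
    (hh : (β, h) ∈ realizers cells) : (⁅α, β⁆, ⁅g, h⁆) ∈ realizers cells :=
  mul_mem (mul_mem (mul_mem hg hh) (inv_mem hg)) (inv_mem hh)

theorem conj_mem_realizers {cells : ι → Fin n × Fin n} {α β : ι → Equiv.Perm Label}
    {g h : Equiv.Perm (Facelet n)} (hg : (α, g) ∈ realizers cells)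
    (hh : (β, h) ∈ realizers cells) : (α * β * α⁻¹, g * h * g⁻¹) ∈ realizers cells :=
  mul_mem (mul_mem hg hh) (inv_mem hg)

variable (cells : ι → Fin n × Fin n)

theorem rot_mem_realizers (a : Fin 3) : (fun _ => Label.rot a, rot a) ∈ realizers cells :=
  fun x => rot_place a (cells x)

theorem turns_mem_realizers (a : Fin 3) (A : Finset (Fin n)) :
    (fun x => Label.turn a fun s b => coord (cells x) s b ∈ A, turns a A) ∈ realizers cells := by
  intro x l
  simp only [turns_apply, place_pos, Label.turn, Equiv.coe_fn_mk, decide_eq_true_eq]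
  by_cases h : coord (cells x) (l.sym a) (l.sign a) ∈ A
  · simpa only [h, if_true] using rot_place a _ l
  · simp only [h, if_false]

theorem exists_mem_realizers_of_mem_moveSet {g : Equiv.Perm (Facelet n)} (hg : g ∈ moveSet n) :
    ∃ α, (α, g) ∈ realizers cells := by
  obtain rfl | ⟨⟨a, i, b⟩, rfl⟩ := hg
  · exact ⟨1, one_mem _⟩
  · have h := turns_mem_realizers cells a {i}
    rw [turns_singleton] at h
    cases b
    · exact ⟨_, inv_mem h⟩
    · exact ⟨_, h⟩

theorem exists_mem_realizers {g : Equiv.Perm (Facelet n)} (hg : g ∈ cubeGroup n) :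
    ∃ α, (α, g) ∈ realizers cells := by
  have hle : cubeGroup n ≤ (realizers cells).map (MonoidHom.snd _ _) :=
    (Subgroup.closure_le _).2 fun g hg =>
      let ⟨α, hα⟩ := exists_mem_realizers_of_mem_moveSet cells hg
      ⟨(α, g), hα, rfl⟩
  obtain ⟨p, hp, rfl⟩ := hle hg
  exact ⟨p.1, hp⟩

end Place

section Cells

open Pointwise

variable {n : ℕ} [NeZero n]

/-- A coordinate strictly between the near side of the cube and the middle. -/
abbrev IsNear (i : Fin n) : Prop := 0 < i ∧ i < i.rev

/-- The middle coordinate if `n` is odd; for even `n`, which has none, it is `0`. -/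
def centre (n : ℕ) [NeZero n] : Fin n :=
  ⟨n % 2 * (n / 2), by
    have := Nat.pos_of_neZero n
    obtain h | h := Nat.mod_two_eq_zero_or_one n <;> rw [h] <;> omega⟩

theorem eq_centre_of_eq_rev {i : Fin n} (hi : i = i.rev) : i = centre n := by
  have hval : (i : ℕ) = n - (i + 1) := (congrArg Fin.val hi).trans (Fin.val_rev i)
  have hodd : n % 2 = 1 := by omega
  simp only [Fin.ext_iff, centre, hodd]
  omega

/-- The cells whose orbits consist of the facelets of the corners and, for odd `n`, of the middles
of the edges and the centres of the sides. -/
def specialCell (x : Fin 2 × Fin 2) : Fin n × Fin n := (![0, centre n] x.1, ![0, centre n] x.2)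

theorem not_isNear_coord_specialCell (x : Fin 2 × Fin 2) (s : Fin 3) (b : Bool) :
    ¬ IsNear (coord (specialCell (n := n) x) s b) := by
  have hzero : ¬ IsNear (0 : Fin n) ∧ ¬ IsNear (0 : Fin n).rev := by
    simp [IsNear]
  have hcentre : ¬ IsNear (centre n) ∧ ¬ IsNear (centre n).rev := by
    simp only [IsNear, Fin.lt_def, Fin.val_rev, centre, Fin.val_zero]
    obtain h | h := Nat.mod_two_eq_zero_or_one n <;> rw [h] <;> omega
  obtain ⟨x, y⟩ := x
  fin_cases x <;> fin_cases y <;> fin_cases s <;> cases b <;>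
    simp [coord, specialCell, hzero, hcentre]

theorem turns_mem_realizers_specialCell (a : Fin 3) {I : Finset (Fin n)}
    (hI : ∀ i ∈ I, IsNear i) : (1, turns a I) ∈ realizers (specialCell (n := n)) := by
  have h := turns_mem_realizers (specialCell (n := n)) a I
  have hI' : ∀ x s b, coord (specialCell x) s b ∉ I := fun x s b h =>
    not_isNear_coord_specialCell x s b (hI _ h)
  simp only [hI', decide_false, Label.turn_false] at h
  exact h

/-- The cells that remain: those in the interior of a quarter of a side, or on its axis, or, if
the second coordinate is `0`, on its border. -/
abbrev NearCell (n : ℕ) [NeZero n] : Type :=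
  {c : Fin n × Fin n // IsNear c.1 ∧ c.2 ≤ c.2.rev}

theorem exists_mem_moveSet_pow_specialCell : ∃ L, ∀ (n : ℕ) [NeZero n], ∀ g ∈ cubeGroup n,
    ∃ w ∈ moveSet n ^ L, (1, w * g) ∈ realizers specialCell := by
  obtain ⟨L, hL⟩ := exists_forall_exists_mem_pow_one_mem (Fin 2 × Fin 2 → Equiv.Perm Label)
  exact ⟨L, fun n _ => hL _ _ one_mem_moveSet fun _ =>
    exists_mem_realizers_of_mem_moveSet specialCell⟩

open scoped commutatorElement

/-- A commutator supported on the orbits of the cells in the rectangle `I × J`. -/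
def cellComm (I J : Finset (Fin n)) : Equiv.Perm (Facelet n) :=
  ⁅turns 0 I, (turns 2 {Fin.rev 0})⁻¹ * turns 0 (J.map Fin.revPerm.toEmbedding) *
    turns 2 {Fin.rev 0}⁆

theorem cellComm_mem_moveSet_pow (I J : Finset (Fin n)) :
    cellComm I J ∈ moveSet n ^ (2 * (I.card + (J.card + 2))) := by
  have hedge := turns_mem_moveSet_pow 2 {Fin.rev (0 : Fin n)}
  refine moveSet_pow_mono (commutator_mem_moveSet_pow (turns_mem_moveSet_pow 0 I)
    (mul_mem_moveSet_pow (mul_mem_moveSet_pow (inv_mem_moveSet_pow hedge)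
      (turns_mem_moveSet_pow 0 _)) hedge)) ?_
  simp only [Finset.card_map, Finset.card_singleton]
  omega

theorem cellComm_mem_realizers_specialCell {I : Finset (Fin n)} (hI : ∀ i ∈ I, IsNear i)
    (J : Finset (Fin n)) : (1, cellComm I J) ∈ realizers (specialCell (n := n)) := by
  have hedge := turns_mem_realizers (specialCell (n := n)) 2 {Fin.rev 0}
  have hJ := turns_mem_realizers (specialCell (n := n)) 0 (J.map Fin.revPerm.toEmbedding)
  have h := commutator_mem_realizers (turns_mem_realizers_specialCell 0 hI)
    (mul_mem (mul_mem (inv_mem hedge) hJ) hedge)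
  rwa [commutatorElement_one_left] at h

theorem IsNear.zero_lt_rev_zero {i : Fin n} (hi : IsNear i) : 0 < Fin.rev (0 : Fin n) :=
  hi.1.trans (hi.2.trans_le (Fin.rev_le_rev.2 (Fin.zero_le i)))

theorem decide_coord_mem_near {I : Finset (Fin n)} (hI : ∀ i ∈ I, IsNear i) (c : NearCell n)
    (s : Fin 3) (b : Bool) :
    decide (coord c s b ∈ I) = (![false, decide (c.1.1 ∈ I), decide (c.1.2 ∈ I)] s && !b) := by
  have hzero : (0 : Fin n) ∉ I := fun h => lt_irrefl _ (hI _ h).1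
  have hrev : ∀ {v : Fin n}, v ≤ v.rev → v.rev ∉ I := fun {v} hv h => by
    have := (hI _ h).2
    rw [Fin.rev_rev] at this
    exact hv.not_gt this
  fin_cases s <;> cases b <;> simp [coord, hrev, hzero, c.2.1.2.le, c.2.2]

theorem decide_coord_mem_singleton_rev_zero (c : NearCell n) (s : Fin 3) (b : Bool) :
    decide (coord c s b ∈ ({Fin.rev 0} : Finset (Fin n))) =
      (![true, false, decide (c.1.2 = 0)] s && b) := by
  have hlt : ∀ {v : Fin n}, v ≤ v.rev → v ≠ Fin.rev 0 := by
    rintro _ hv rfl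
    rw [Fin.rev_rev] at hv
    exact hv.not_gt c.2.1.zero_lt_rev_zero
  fin_cases s <;> cases b <;>
    simp [coord, hlt, c.2.1.2.le, c.2.2, c.2.1.1.ne']

theorem decide_coord_mem_map_rev {J : Finset (Fin n)} (hJ : ∀ j ∈ J, j ≤ j.rev)
    (c : NearCell n) (s : Fin 3) (b : Bool) :
    decide (coord c s b ∈ J.map Fin.revPerm.toEmbedding) =
      (![decide (0 ∈ J), decide (c.1.1 ∈ J), decide (c.1.2 ∈ J)] s &&
        (b || ![false, false, decide (c.1.2 = c.1.2.rev)] s)) := by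
  have hrev : ∀ {v : Fin n}, v ≤ v.rev → (v.rev ∈ J ↔ v ∈ J ∧ v = v.rev) := fun {v} hv => by
    refine ⟨fun h => ?_, fun h => h.2 ▸ h.1⟩
    have heq := le_antisymm hv (by simpa using hJ _ h)
    exact ⟨heq ▸ h, heq⟩
  fin_cases s <;> cases b <;>
    simp [coord, Finset.mem_map_equiv, hrev, c.2.1.2.le, c.2.1.2.ne, c.2.2,
      c.2.1.zero_lt_rev_zero.ne]

theorem cellComm_mem_realizers {I J : Finset (Fin n)} (hI : ∀ i ∈ I, IsNear i)
    (hJ : ∀ j ∈ J, j ≤ j.rev) :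
    ({c : NearCell n | c.1.1 ∈ I ∧ c.1.2 ∈ J}.mulIndicator fun _ => Label.cycle, cellComm I J) ∈
      realizers Subtype.val := by
  have hnear : (fun c : NearCell n => Label.turn 0 fun s b =>
      ![false, decide (c.1.1 ∈ I), decide (c.1.2 ∈ I)] s && !b, turns 0 I) ∈
      realizers Subtype.val := by
    simpa only [decide_coord_mem_near hI] using
      turns_mem_realizers (Subtype.val : NearCell n → _) 0 I
  have hedge : (fun c : NearCell n => Label.turn 2 fun s b =>
      ![true, false, decide (c.1.2 = 0)] s && b, turns 2 {Fin.rev 0}) ∈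
      realizers Subtype.val := by
    simpa only [decide_coord_mem_singleton_rev_zero] using
      turns_mem_realizers (Subtype.val : NearCell n → _) 2 {Fin.rev 0}
  have hfar : (fun c : NearCell n => Label.turn 0 fun s b =>
      ![decide (0 ∈ J), decide (c.1.1 ∈ J), decide (c.1.2 ∈ J)] s &&
        (b || ![false, false, decide (c.1.2 = c.1.2.rev)] s),
      turns 0 (J.map Fin.revPerm.toEmbedding)) ∈ realizers Subtype.val := by
    simpa only [decide_coord_mem_map_rev hJ] using
      turns_mem_realizers (Subtype.val : NearCell n → _) 0 (J.map Fin.revPerm.toEmbedding)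
  convert commutator_mem_realizers hnear (mul_mem (mul_mem (inv_mem hedge) hfar) hedge) using 1
  refine Prod.ext (funext fun c => ?_) rfl
  refine Eq.trans ?_ (Label.commutator_turn _ _ _ _ _ _ _ ?_ ?_).symm
  · simp [Set.mulIndicator]
  · rw [Bool.and_eq_true, Bool.not_eq_true', Bool.not_eq_true', decide_eq_true_eq,
      decide_eq_false_iff_not, decide_eq_false_iff_not]
    exact fun h => ⟨(hI _ h).2.ne, (hI _ h).1.ne'⟩
  · rw [Bool.and_eq_true, Bool.not_eq_true', decide_eq_true_eq, decide_eq_false_iff_not]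
    intro h
    rw [h]
    exact ⟨c.2.1.zero_lt_rev_zero.ne, beq_self_eq_true _⟩

end Cells

theorem sum_powerset_card_le {ι κ : Type*} [Fintype κ] {Y : Finset ι} {rows : Finset ι → Finset κ}
    (hrows : (Y.powerset : Set (Finset ι)).PairwiseDisjoint rows) :
    ∑ T ∈ Y.powerset, 2 * ((rows T).card + (T.card + 2)) ≤
      2 * Fintype.card κ + 2 ^ Y.card * (2 * (Y.card + 2)) := by
  classical
  have hcard : ∑ T ∈ Y.powerset, (rows T).card ≤ Fintype.card κ := by
    rw [← Finset.card_biUnion hrows]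
    exact Finset.card_le_univ _
  have hle : ∀ T ∈ Y.powerset, 2 * (T.card + 2) ≤ 2 * (Y.card + 2) := fun T hT => by
    have := Finset.card_le_card (Finset.mem_powerset.1 hT)
    omega
  calc ∑ T ∈ Y.powerset, 2 * ((rows T).card + (T.card + 2))
      = 2 * ∑ T ∈ Y.powerset, (rows T).card + ∑ T ∈ Y.powerset, 2 * (T.card + 2) := by
        simp only [mul_add, Finset.sum_add_distrib, Finset.mul_sum]
    _ ≤ 2 * Fintype.card κ + 2 ^ Y.card * (2 * (Y.card + 2)) := by
        rw [← Finset.card_powerset, ← smul_eq_mul (Finset.card _)]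
        exact add_le_add (Nat.mul_le_mul_left 2 hcard) (Finset.sum_le_card_nsmul _ _ _ hle)

section Realizable

open Pointwise

variable {n k l : ℕ} [NeZero n]

/-- The families of label permutations which at most `k` moves can realize on the orbits of the
near cells without changing the orbits of the special ones. -/
def realizable (n k : ℕ) [NeZero n] : Set (NearCell n → Equiv.Perm Label) :=
  {α | ∃ w ∈ moveSet n ^ k, (α, w) ∈ realizers Subtype.val ∧ (1, w) ∈ realizers specialCell}

variable {α β : NearCell n → Equiv.Perm Label}

theorem one_mem_realizable : 1 ∈ realizable n k :=
  ⟨1, one_mem_moveSet_pow, one_mem _, one_mem _⟩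

theorem realizable_mono (hα : α ∈ realizable n k) (hkl : k ≤ l) : α ∈ realizable n l :=
  hα.imp fun _ h => ⟨moveSet_pow_mono h.1 hkl, h.2⟩

theorem mul_mem_realizable (hα : α ∈ realizable n k) (hβ : β ∈ realizable n l) :
    α * β ∈ realizable n (k + l) := by
  obtain ⟨v, hv, hvn, hvs⟩ := hα
  obtain ⟨w, hw, hwn, hws⟩ := hβ
  exact ⟨v * w, mul_mem_moveSet_pow hv hw, mul_mem hvn hwn, by simpa using mul_mem hvs hws⟩

theorem rot_conj_mem_realizable (a : Fin 3) (hα : α ∈ realizable n k) :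
    (fun c => Label.rot a * α c * (Label.rot a)⁻¹) ∈ realizable n k := by
  obtain ⟨w, hw, hwn, hws⟩ := hα
  exact ⟨_, rot_conj_mem_moveSet_pow a hw, conj_mem_realizers (rot_mem_realizers _ a) hwn,
    by simpa using conj_mem_realizers (rot_mem_realizers _ a) hws⟩

theorem conj_mem_realizable {σ : Equiv.Perm Label}
    (hσ : σ ∈ Subgroup.closure (Set.range Label.rot)) (hα : α ∈ realizable n k) :
    (fun c => σ * α c * σ⁻¹) ∈ realizable n k := by
  rw [← Subgroup.mem_toSubmonoid, Subgroup.closure_toSubmonoid_of_finite] at hσ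
  induction hσ using Submonoid.closure_induction generalizing α with
  | mem σ hσ =>
    obtain ⟨a, rfl⟩ := hσ
    exact rot_conj_mem_realizable a hα
  | one => simpa using hα
  | mul σ τ _ _ ihσ ihτ => simpa [mul_assoc] using ihσ (ihτ hα)

theorem mulIndicator_rectangle_mem_realizable {t : Equiv.Perm Label} (ht : t ∈ Label.cycles)
    {I J : Finset (Fin n)} (hI : ∀ i ∈ I, IsNear i) (hJ : ∀ j ∈ J, j ≤ j.rev) :
    {c : NearCell n | c.1.1 ∈ I ∧ c.1.2 ∈ J}.mulIndicator (fun _ => t) ∈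
      realizable n (2 * (I.card + (J.card + 2))) := by
  obtain ⟨σ, hσ, rfl⟩ := ht
  convert conj_mem_realizable hσ ⟨cellComm I J, cellComm_mem_moveSet_pow I J,
    cellComm_mem_realizers hI hJ, cellComm_mem_realizers_specialCell hI J⟩ using 1
  ext1 c
  by_cases hc : c.1.1 ∈ I ∧ c.1.2 ∈ J <;> simp [hc]

theorem mulIndicator_biUnion_mem_realizable {ι : Type*} {R : Finset ι} {C : ι → Set (NearCell n)}
    {k : ι → ℕ} (hdisj : (R : Set ι).PairwiseDisjoint C)
    (hC : ∀ r ∈ R, (C r).mulIndicator α ∈ realizable n (k r)) :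
    (⋃ r ∈ R, C r).mulIndicator α ∈ realizable n (∑ r ∈ R, k r) := by
  classical
  induction R using Finset.induction_on with
  | empty => simpa [Pi.one_def] using one_mem_realizable (n := n)
  | insert r R hr ih =>
    rw [Finset.coe_insert, Set.pairwiseDisjoint_insert_of_notMem (by simpa using hr)] at hdisj
    rw [Finset.set_biUnion_insert, Set.mulIndicator_union_of_disjoint, Finset.sum_insert hr]
    · exact mul_mem_realizable (hC r (Finset.mem_insert_self r R))
        (ih hdisj.1 fun s hs => hC s (Finset.mem_insert_of_mem hs))
    · exact Set.disjoint_iUnion₂_right.2 hdisj.2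

theorem mulIndicator_columns_mem_realizable {t : Equiv.Perm Label} (ht : t ∈ Label.cycles)
    (S : Set (NearCell n)) {Y : Finset (Fin n)} (hY : ∀ j ∈ Y, j ≤ j.rev) :
    (S ∩ {c | c.1.2 ∈ Y}).mulIndicator (fun _ => t) ∈
      realizable n (2 * n + 2 ^ Y.card * (2 * (Y.card + 2))) := by
  classical
  let cell (i j : Fin n) : Prop := ∃ h, (⟨(i, j), h⟩ : NearCell n) ∈ S
  let rows (T : Finset (Fin n)) : Finset (Fin n) := {i | IsNear i ∧ {j ∈ Y | cell i j} = T}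
  let C (T : Finset (Fin n)) : Set (NearCell n) := {c | c.1.1 ∈ rows T ∧ c.1.2 ∈ T}
  have hC : ∀ T ∈ Y.powerset, (C T).mulIndicator (fun _ => t) ∈
      realizable n (2 * ((rows T).card + (T.card + 2))) := fun T hT =>
    mulIndicator_rectangle_mem_realizable ht (fun i hi => (Finset.mem_filter.1 hi).2.1)
      fun j hj => hY j (Finset.mem_powerset.1 hT hj)
  have hrows : (Y.powerset : Set (Finset (Fin n))).PairwiseDisjoint rows := fun T _ U _ hne =>
    Finset.disjoint_left.2 fun i hi hi' =>
      hne ((Finset.mem_filter.1 hi).2.2.symm.trans (Finset.mem_filter.1 hi').2.2)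
  have hdisj : (Y.powerset : Set (Finset (Fin n))).PairwiseDisjoint C := fun T hT U hU hne =>
    Set.disjoint_left.2 fun c hc hc' => Finset.disjoint_left.1 (hrows hT hU hne) hc.1 hc'.1
  have hunion : S ∩ {c | c.1.2 ∈ Y} = ⋃ T ∈ Y.powerset, C T := by
    ext c
    simp only [C, rows, cell, Set.mem_inter_iff, Set.mem_ofPred_eq, Set.mem_iUnion, exists_prop,
      Finset.mem_powerset, Finset.mem_filter, Finset.mem_univ, true_and]
    constructor
    · rintro ⟨hS, hY⟩
      exact ⟨_, Finset.filter_subset _ Y, ⟨c.2.1, rfl⟩, Finset.mem_filter.2 ⟨hY, c.2, hS⟩⟩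
    · rintro ⟨T, hT, ⟨-, rfl⟩, hc⟩
      obtain ⟨hY, _, hS⟩ := Finset.mem_filter.1 hc
      exact ⟨hS, hY⟩
  rw [hunion]
  exact realizable_mono (mulIndicator_biUnion_mem_realizable hdisj hC)
    (by simpa using sum_powerset_card_le hrows)

end Realizable

section EvenFamilies

open Pointwise

variable {n : ℕ} [NeZero n]

/-- The cost of applying a label permutation in an arbitrary set of near cells, when the columns
are treated in blocks of `b`. -/
def blockBound (n b : ℕ) : ℕ := (n / b + 1) * (2 * n + 2 ^ b * (2 * (b + 2)))

theorem mulIndicator_const_mem_realizable {b : ℕ} (hb : 0 < b) {t : Equiv.Perm Label}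
    (ht : t ∈ Label.cycles) (S : Set (NearCell n)) :
    S.mulIndicator (fun _ => t) ∈ realizable n (blockBound n b) := by
  let Y (m : ℕ) : Finset (Fin n) := {j | j ≤ j.rev ∧ j / b = m}
  let C (m : ℕ) : Set (NearCell n) := S ∩ {c | c.1.2 ∈ Y m}
  have hcard : ∀ m, (Y m).card ≤ b := fun m => by
    have hmaps : Set.MapsTo Fin.val (Y m : Set (Fin n)) (Finset.Ico (m * b) (m * b + b)) :=
      fun j hj => by
        have := (Nat.div_eq_iff hb).1 (Finset.mem_filter.1 hj).2.2
        simp only [Finset.coe_Ico, Set.mem_Ico]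
        omega
    simpa using Finset.card_le_card_of_injOn Fin.val hmaps Fin.val_injective.injOn
  have hC : ∀ m ∈ Finset.range (n / b + 1),
      (C m).mulIndicator (fun _ => t) ∈ realizable n (2 * n + 2 ^ b * (2 * (b + 2))) :=
    fun m _ => realizable_mono
      (mulIndicator_columns_mem_realizable ht S fun j hj => (Finset.mem_filter.1 hj).2.1) (by
        gcongr
        · exact one_le_two
        · exact hcard m
        · exact hcard m)
  have hdisj : (Finset.range (n / b + 1) : Set ℕ).PairwiseDisjoint C := fun l _ m _ hne =>
    Set.disjoint_left.2 fun c ⟨_, (hl : c.1.2 ∈ Y l)⟩ ⟨_, (hm : c.1.2 ∈ Y m)⟩ =>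
      hne ((Finset.mem_filter.1 hl).2.2.symm.trans (Finset.mem_filter.1 hm).2.2)
  have hunion : S = ⋃ m ∈ Finset.range (n / b + 1), C m := by
    ext c
    have hle := Nat.div_le_div_right (c := b) c.1.2.is_lt.le
    simpa [C, Y, c.2.2] using fun _ => hle
  rw [hunion]
  exact realizable_mono (mulIndicator_biUnion_mem_realizable hdisj hC) (by simp [blockBound])

theorem mem_realizable_of_forall_mem_cycles {b : ℕ} (hb : 0 < b)
    {α : NearCell n → Equiv.Perm Label} (hα : ∀ c, α c ∈ insert 1 Label.cycles) :
    α ∈ realizable n (Label.cycles.ncard * blockBound n b) := by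
  let R := Label.cycles.toFinite.toFinset
  have hR : ∀ t ∈ R, (α ⁻¹' {t}).mulIndicator α ∈ realizable n (blockBound n b) := fun t ht => by
    have hconst : (α ⁻¹' {t}).mulIndicator α = (α ⁻¹' {t}).mulIndicator fun _ => t :=
      Set.mulIndicator_congr fun c hc => hc
    rw [hconst]
    exact mulIndicator_const_mem_realizable hb ((Set.Finite.mem_toFinset _).1 ht) _
  have hdisj : (R : Set (Equiv.Perm Label)).PairwiseDisjoint fun t => α ⁻¹' {t} :=
    Set.pairwiseDisjoint_fiber α _
  have hsupp : (⋃ t ∈ R, α ⁻¹' {t}).mulIndicator α = α := by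
    rw [Set.mulIndicator_eq_self]
    intro c hc
    simpa [R] using (hα c).resolve_left hc
  rw [← hsupp, Set.ncard_eq_toFinset_card _]
  simpa using mulIndicator_biUnion_mem_realizable hdisj hR

theorem mem_realizable_of_forall_mem_pow {S : Set (Equiv.Perm Label)} {N : ℕ}
    (hS : ∀ α : NearCell n → Equiv.Perm Label, (∀ c, α c ∈ S) → α ∈ realizable n N) (K : ℕ)
    {α : NearCell n → Equiv.Perm Label} (hα : ∀ c, α c ∈ S ^ K) : α ∈ realizable n (K * N) := by
  induction K generalizing α with
  | zero =>
    have hone : α = 1 := funext fun c => Set.mem_one.1 (pow_zero S ▸ hα c)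
    exact hone ▸ one_mem_realizable
  | succ K ih =>
    have hmul : ∀ c, ∃ x ∈ S ^ K, ∃ y ∈ S, x * y = α c := fun c =>
      Set.mem_mul.1 (pow_succ S K ▸ hα c)
    choose β hβ γ hγ hβγ using hmul
    rw [add_one_mul, ← show β * γ = α from funext hβγ]
    exact mul_mem_realizable (ih hβ) (hS γ hγ)

theorem exists_mem_realizable_of_forall_even : ∃ K, ∀ (n b : ℕ) [NeZero n], 0 < b →
    ∀ α : NearCell n → Equiv.Perm Label, (∀ c, α c ∈ alternatingGroup Label) →
      α ∈ realizable n (K * blockBound n b) := by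
  obtain ⟨K, hK⟩ := exists_forall_closure_subset_pow (Equiv.Perm Label)
  refine ⟨K * Label.cycles.ncard, fun n b _ hb α hα => ?_⟩
  rw [mul_assoc]
  refine mem_realizable_of_forall_mem_pow
    (fun _ => mem_realizable_of_forall_mem_cycles hb) K fun c => hK _ (Set.mem_insert _ _) ?_
  rw [Subgroup.closure_insert_one, Label.closure_cycles]
  exact hα c

end EvenFamilies

namespace Label

/-- The label of the other facelet on the same cubie, for cells whose first coordinate is `0`; the
roles of the reference coordinates are permuted cyclically. -/
def twin (l : Label) : Label :=
  (l.1 + if xor (l.sign 0) (xor (l.sign 1) (l.sign 2)) then 1 else 2, l.2)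

theorem sign_twin (l : Label) (a : Fin 3) : l.twin.sign a = l.sign a := rfl

theorem sym_twin (l : Label) (a : Fin 3) : l.twin.sym a = l.sym a - 1 := by
  revert l a; decide

theorem eq_axis_or_eq_axis_twin {l : Label} {a : Fin 3} (ha : l.sym a ≠ 2) :
    a = l.1 ∨ a = l.twin.1 := by
  revert l a; decide

theorem face_twin_ne (l : Label) : l.twin.face ≠ l.face := by
  revert l; decide

/-- The label with the same face whose sign differs along the axis of the reference coordinate `1`;
this reflection exchanges the reference coordinates `1` and `2`. -/
def flip (l : Label) : Label := mk l.1 fun a => xor (l.sign a) (l.sym a = 1)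

theorem sign_flip (l : Label) (a : Fin 3) : l.flip.sign a = xor (l.sign a) (l.sym a = 1) := by
  revert l a; decide

theorem sym_flip (l : Label) (a : Fin 3) : l.flip.sym a = Equiv.swap 1 2 (l.sym a) := by
  revert l a; decide

theorem face_flip (l : Label) : l.flip.face = l.face := by
  revert l; decide

theorem sign_mk (f : Fin 3) (e : Fin 3 → Bool) (a : Fin 3) : (mk f e).sign a = e a := by
  fin_cases a <;> rfl

theorem exists_sym_cases (l : Label) : ∃ a₁ a₂, ∀ a, a = l.1 ∧ l.sym a = 0 ∨
    a = a₁ ∧ a ≠ l.1 ∧ l.sym a = 1 ∨ a = a₂ ∧ a ≠ l.1 ∧ l.sym a = 2 := by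
  revert l; decide

/-- An odd permutation can only be corrected up to a transposition; that transposition is chosen
inside a single side of the cube, where it is invisible. -/
theorem exists_even_mul_face_eq (π : Equiv.Perm Label) : ∃ δ ∈ alternatingGroup Label,
    (∀ l, ((δ * π) l).face = l.face) ∧ (π ∈ alternatingGroup Label → δ * π = 1) := by
  by_cases hπ : π ∈ alternatingGroup Label
  · exact ⟨π⁻¹, inv_mem hπ, by simp, by simp⟩
  · let τ : Equiv.Perm Label := Equiv.swap (0, false, false, false) (0, false, true, false)
    have hτ : ∀ l, (τ l).face = l.face := by decide
    refine ⟨τ * π⁻¹, ?_, by simpa using hτ, fun h => (hπ h).elim⟩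
    rw [Equiv.Perm.mem_alternatingGroup] at hπ ⊢
    rw [Equiv.Perm.sign_mul, Equiv.Perm.sign_inv, Equiv.Perm.sign_swap (by decide),
      (Int.units_eq_one_or _).resolve_left hπ]
    rfl

end Label

section Coverage

variable {n : ℕ} [NeZero n]

theorem place_swap {i j : Fin n} (hi : i = i.rev) (l : Label) :
    place (j, i) l.flip = place (i, j) l := by
  refine Facelet.ext (funext fun a => ?_) l.face_flip
  simp only [place_pos, Label.sym_flip, Label.sign_flip, coord]
  obtain h | h | h : l.sym a = 0 ∨ l.sym a = 1 ∨ l.sym a = 2 := by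
    generalize l.sym a = s; revert s; decide
  all_goals cases l.sign a <;> simp [h, ← hi, Equiv.swap_apply_of_ne_of_ne]

theorem place_twin_pos (i : Fin n) (l : Label) :
    (place (i, 0) l.twin).pos = (place (0, i) l).pos := by
  funext a
  simp only [place_pos, Label.sym_twin, Label.sign_twin, coord]
  generalize l.sym a = s
  fin_cases s <;> rfl

theorem eq_face_or_eq_face_twin_of_visible {i : Fin n} (hi : IsNear i) {l : Label} {f : Face}
    (hf : Visible (place (0, i) l).pos f) : f = l.face ∨ f = l.twin.face := by
  obtain ⟨a, e⟩ := f
  have hcoord : l.sym a ≠ 2 ∧ e = l.sign a := by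
    have hi₀ := hi.1
    have hi₁ := hi.2
    simp only [Fin.lt_def, Fin.val_rev, Fin.val_zero] at hi₀ hi₁
    simp only [Visible, place_pos, coord] at hf
    generalize l.sym a = s at hf ⊢
    generalize l.sign a = d at hf ⊢
    fin_cases s <;> cases d <;> cases e <;> simp [Fin.val_rev] at hf ⊢ <;> omega
  obtain ⟨hsym, rfl⟩ := hcoord
  obtain rfl | rfl := Label.eq_axis_or_eq_axis_twin hsym
  · exact Or.inl rfl
  · exact Or.inr rfl

theorem exists_place_eq (s : Facelet n) :
    ∃ c l, c.1 ≤ c.1.rev ∧ c.2 ≤ c.2.rev ∧ place c l = s := by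
  obtain ⟨p, ⟨f, b⟩, hv⟩ := s
  let l := Label.mk f fun a => if a = f then b else decide ((p a).rev < p a)
  have hsign (a : Fin 3) : l.sign a = if a = f then b else decide ((p a).rev < p a) :=
    Label.sign_mk _ _ a
  have hnear (v : Fin n) : min v v.rev ≤ (min v v.rev).rev := by
    rcases le_total v v.rev with h | h <;> simp [h]
  have hcoord (v : Fin n) :
      (if v.rev < v then (min v v.rev).rev else min v v.rev) = v := by
    split_ifs with h
    · rw [min_eq_right h.le, Fin.rev_rev]
    · exact min_eq_left (not_lt.1 h)
  have hextreme : (if b then Fin.rev 0 else 0) = p f := by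
    have hn := Nat.pos_of_neZero n
    cases b <;> simp only [Visible, Bool.false_eq_true, if_true, if_false] at hv ⊢
    · exact Fin.ext (by simp [hv])
    · exact Fin.ext (by simp only [Fin.val_rev, Fin.val_zero]; omega)
  obtain ⟨a₁, a₂, hcases⟩ := l.exists_sym_cases
  refine ⟨(min (p a₁) (p a₁).rev, min (p a₂) (p a₂).rev), l, hnear _, hnear _,
    Facelet.ext (funext fun a => ?_) (Prod.ext rfl ((hsign f).trans (if_pos rfl)))⟩
  rw [place_pos, hsign]
  obtain ⟨rfl, hsym⟩ | ⟨rfl, ha, hsym⟩ | ⟨rfl, ha, hsym⟩ := hcases a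
  · rw [hsym, if_pos rfl]
    exact hextreme
  · rw [hsym, if_neg (show a ≠ f from ha)]
    simpa [coord] using hcoord (p a)
  · rw [hsym, if_neg (show a ≠ f from ha)]
    simpa [coord] using hcoord (p a)

theorem apply_place_zero_eq_self {g : Equiv.Perm (Facelet n)} (hg : g ∈ cubeGroup n) {i : Fin n}
    (hi : IsNear i) (hfix : ∀ l, g (place (i, 0) l) = place (i, 0) l) (l : Label) :
    g (place (0, i) l) = place (0, i) l := by
  have hpos : (g (place (0, i) l)).pos = (place (0, i) l).pos := by
    rw [← place_twin_pos, ← hfix l.twin]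
    exact pos_eq_pos_of_mem_cubeGroup hg (place_twin_pos i l).symm
  refine Facelet.ext hpos ?_
  refine (eq_face_or_eq_face_twin_of_visible hi (hpos ▸ (g (place (0, i) l)).visible)).resolve_right
    fun hface => l.face_twin_ne ?_
  have htwin : g (place (0, i) l) = g (place (i, 0) l.twin) := by
    rw [hfix]
    exact Facelet.ext (hpos.trans (place_twin_pos i l).symm) hface
  exact (congrArg Facelet.face (g.injective htwin)).symm

theorem exists_specialCell_eq {c : Fin n × Fin n} (h₁ : c.1 = 0 ∨ c.1 = c.1.rev)
    (h₂ : c.2 = 0 ∨ c.2 = c.2.rev) : ∃ x, specialCell x = c := by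
  have hcoord : ∀ i : Fin n, i = 0 ∨ i = i.rev → ∃ x, ![0, centre n] x = i := by
    rintro i (rfl | hi)
    · exact ⟨0, rfl⟩
    · exact ⟨1, (eq_centre_of_eq_rev hi).symm⟩
  obtain ⟨x, hx⟩ := hcoord _ h₁
  obtain ⟨y, hy⟩ := hcoord _ h₂
  exact ⟨(x, y), Prod.ext hx hy⟩

theorem face_apply_eq {g : Equiv.Perm (Facelet n)} (hg : g ∈ cubeGroup n)
    (hspecial : (1, g) ∈ realizers (specialCell (n := n))) {α : NearCell n → Equiv.Perm Label}
    (hα : (α, g) ∈ realizers Subtype.val) (hface : ∀ c l, (α c l).face = l.face)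
    (hedge : ∀ c : NearCell n, c.1.2 = 0 → α c = 1) (s : Facelet n) : (g s).face = s.face := by
  have near_or {i : Fin n} (hi : i ≤ i.rev) : IsNear i ∨ i = 0 ∨ i = i.rev := by
    obtain h₀ | h₀ := eq_or_ne i 0
    · exact Or.inr (Or.inl h₀)
    · exact hi.lt_or_eq.imp (fun h => ⟨lt_of_le_of_ne (Fin.zero_le i) h₀.symm, h⟩) Or.inr
  have hnear {i j : Fin n} (hi : IsNear i) (hj : j ≤ j.rev) (l : Label) :
      (g (place (i, j) l)).face = l.face := by
    rw [hα ⟨(i, j), hi, hj⟩ l]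
    exact hface _ l
  obtain ⟨⟨i, j⟩, l, hi, hj, rfl⟩ := exists_place_eq s
  obtain hi' | hi' := near_or hi
  · exact hnear hi' hj l
  obtain hj' | hj' := near_or hj
  · obtain rfl | hrev := hi'
    · refine congrArg Facelet.face (apply_place_zero_eq_self hg hj' (fun l => ?_) l)
      refine (hα ⟨(j, 0), hj', Fin.zero_le _⟩ l).trans (congrArg (place (j, 0)) ?_)
      exact DFunLike.congr_fun (hedge ⟨(j, 0), hj', Fin.zero_le _⟩ rfl) l
    · rw [← place_swap hrev]
      exact hnear hj' hi l.flip
  · obtain ⟨x, hx⟩ := exists_specialCell_eq hi' hj'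
    rw [← hx]
    exact congrArg Facelet.face (hspecial x l)

end Coverage

section Solution

open Pointwise

variable {n : ℕ} [NeZero n]

theorem exists_turns_mul_even_of_snd_eq_zero {α : NearCell n → Equiv.Perm Label}
    {g : Equiv.Perm (Facelet n)} (hα : (α, g) ∈ realizers Subtype.val) :
    ∃ I : Finset (Fin n), (∀ i ∈ I, IsNear i) ∧ ∃ β : NearCell n → Equiv.Perm Label,
      (β, turns 0 I * g) ∈ realizers Subtype.val ∧
        ∀ c, c.1.2 = 0 → β c ∈ alternatingGroup Label := by
  classical
  let I : Finset (Fin n) :=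
    {i | ∃ c : NearCell n, c.1 = (i, 0) ∧ α c ∉ alternatingGroup Label}
  have hI : ∀ i ∈ I, IsNear i := fun i hi => by
    obtain ⟨c, hc, -⟩ := (Finset.mem_filter.1 hi).2
    obtain rfl : c.1.1 = i := congrArg Prod.fst hc
    exact c.2.1
  have hmem (c : NearCell n) (hc : c.1.2 = 0) : c.1.1 ∈ I ↔ α c ∉ alternatingGroup Label := by
    have hc' : c.1 = (c.1.1, 0) := Prod.ext rfl hc
    refine ⟨fun h => ?_, fun h => Finset.mem_filter.2 ⟨Finset.mem_univ _, c, hc', h⟩⟩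
    obtain ⟨d, hd, h⟩ := (Finset.mem_filter.1 h).2
    exact Subtype.ext (hd.trans hc'.symm) ▸ h
  refine ⟨I, hI, _, mul_mem (turns_mem_realizers Subtype.val 0 I) hα, fun c hc => ?_⟩
  have hzero : (0 : Fin n) ∉ I := fun h => lt_irrefl _ (hI _ h).1
  simp only [Pi.mul_apply, decide_coord_mem_near hI, hc, hzero, decide_false,
    Equiv.Perm.mem_alternatingGroup, map_mul, Label.sign_turn_near, decide_eq_true_eq, hmem c hc]
  obtain h | h := Int.units_eq_one_or (Equiv.Perm.sign (α c)) <;> simp [h]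

theorem le_blockBound (n b : ℕ) : n ≤ blockBound n b := by
  have h := Nat.le_mul_of_pos_left (2 * n + 2 ^ b * (2 * (b + 2))) (n / b).succ_pos
  exact (by omega : n ≤ 2 * n + 2 ^ b * (2 * (b + 2))).trans h

theorem exists_mem_moveSet_pow_face_eq : ∃ K, ∀ (n b : ℕ) [NeZero n], 0 < b →
    ∀ g ∈ cubeGroup n, ∃ w ∈ moveSet n ^ (K * blockBound n b),
      ∀ s, (w (g s)).face = s.face := by
  obtain ⟨L, hL⟩ := exists_mem_moveSet_pow_specialCell
  obtain ⟨K, hK⟩ := exists_mem_realizable_of_forall_even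
  refine ⟨L + 1 + K, fun n b _ hb g hg => ?_⟩
  obtain ⟨w₁, hw₁, hspecial₁⟩ := hL n g hg
  have hg₁ : w₁ * g ∈ cubeGroup n := mul_mem (mem_cubeGroup_of_mem_moveSet_pow hw₁) hg
  obtain ⟨α, hα⟩ := exists_mem_realizers (Subtype.val : NearCell n → _) hg₁
  obtain ⟨I, hI, β, hβ, heven⟩ := exists_turns_mul_even_of_snd_eq_zero hα
  choose δ hδ hface hone using fun c => Label.exists_even_mul_face_eq (β c)
  obtain ⟨w₃, hw₃, hnear₃, hspecial₃⟩ := hK n b hb δ hδ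
  have hw : w₃ * (turns 0 I * w₁) ∈ moveSet n ^ ((L + 1 + K) * blockBound n b) := by
    refine moveSet_pow_mono
      (mul_mem_moveSet_pow hw₃ (mul_mem_moveSet_pow (turns_mem_moveSet_pow 0 I) hw₁)) ?_
    have hcard : I.card ≤ blockBound n b :=
      (card_finset_fin_le I).trans (le_blockBound n b)
    have hLle : L ≤ L * blockBound n b :=
      Nat.le_mul_of_pos_right L ((Nat.pos_of_neZero n).trans_le (le_blockBound n b))
    linarith
  refine ⟨_, hw, face_apply_eq (α := δ * β)
    (mul_mem (mem_cubeGroup_of_mem_moveSet_pow hw) hg) ?_ ?_ hface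
    fun c hc => hone c (heven c hc)⟩
  · simpa [mul_assoc] using
      mul_mem hspecial₃ (mul_mem (turns_mem_realizers_specialCell 0 hI) hspecial₁)
  · simpa [mul_assoc] using mul_mem hnear₃ hβ

end Solution

section Configurations

open Pointwise

variable {n : ℕ}

theorem Configuration.moves_append (c : Configuration n) (l l' : List (Move n)) :
    c.moves (l ++ l') = (c.moves l).moves l' :=
  List.foldl_append

theorem Configuration.move_perm_apply (c : Configuration n) (m : Move n) (s : Facelet n) :
    c.move m (m.perm s) = c s :=
  congrArg c (m.perm.symm_apply_apply s)

theorem exists_moves_of_mem_moveSet_pow {g : Equiv.Perm (Facelet n)} {k : ℕ}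
    (hg : g ∈ moveSet n ^ k) : ∃ l : List (Move n), l.length ≤ k ∧
      ∀ (c : Configuration n) (s : Facelet n), c.moves l (g s) = c s := by
  induction k generalizing g with
  | zero =>
    obtain rfl : g = 1 := by simpa using hg
    exact ⟨[], le_rfl, fun _ _ => rfl⟩
  | succ k ih =>
    rw [pow_succ'] at hg
    obtain ⟨h, hh, g, hg, rfl⟩ := hg
    obtain ⟨l, hl, hc⟩ := ih hg
    obtain rfl | ⟨m, rfl⟩ := hh
    · exact ⟨l, hl.trans k.le_succ, fun c s => hc c s⟩
    · refine ⟨l ++ [m], by simpa using hl, fun c s => ?_⟩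
      rw [Configuration.moves_append]
      exact ((c.moves l).move_perm_apply m (g s)).trans (hc c s)

theorem exists_mem_cubeGroup_of_moves (c : Configuration n) (l : List (Move n)) :
    ∃ g ∈ cubeGroup n, ∀ s, c.moves l (g s) = c s := by
  induction l using List.reverseRecOn with
  | nil => exact ⟨1, one_mem _, fun _ => rfl⟩
  | append_singleton l m ih =>
    obtain ⟨g, hg, hc⟩ := ih
    refine ⟨m.perm * g, mul_mem (Subgroup.subset_closure (perm_mem_moveSet m)) hg, fun s => ?_⟩
    rw [Configuration.moves_append]
    exact ((c.moves l).move_perm_apply m (g s)).trans (hc s)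

theorem Configuration.IsReachable.exists_moves_isSolved {k : ℕ}
    (hk : ∀ g ∈ cubeGroup n, ∃ w ∈ moveSet n ^ k, ∀ s, (w (g s)).face = s.face)
    {c : Configuration n} (hc : c.IsReachable) :
    ∃ l : List (Move n), l.length ≤ k ∧ (c.moves l).IsSolved := by
  obtain ⟨c₀, ⟨col, hcol, hc₀⟩, l₀, rfl⟩ := hc
  obtain ⟨g, hg, hgc⟩ := exists_mem_cubeGroup_of_moves c₀ l₀
  obtain ⟨w, hw, hface⟩ := hk g hg
  obtain ⟨l, hl, hlc⟩ := exists_moves_of_mem_moveSet_pow hw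
  refine ⟨l, hl, col, hcol, fun s => ?_⟩
  obtain ⟨t, rfl⟩ := (w * g).surjective s
  rw [Equiv.Perm.mul_apply, hlc, hgc, hc₀, hface]

end Configurations

section Bound

theorem two_pow_succ_mul_le {n a : ℕ} (hn : n ≠ 0) (ha : 2 * a ≤ Nat.log 2 n) :
    2 ^ (a + 1) * (2 * (a + 3)) ≤ 12 * n := by
  have hpow : 2 ^ a * 2 ^ a ≤ n := by
    rw [← pow_add, ← two_mul]
    exact (Nat.pow_le_pow_right two_pos ha).trans (Nat.pow_log_le_self 2 hn)
  have hlt : a < 2 ^ a := Nat.lt_two_pow_self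
  calc 2 ^ (a + 1) * (2 * (a + 3)) = 4 * (2 ^ a * (a + 3)) := by ring
    _ ≤ 4 * (2 ^ a * (3 * 2 ^ a)) := by gcongr; omega
    _ ≤ 12 * n := by linarith

theorem log_le_two_mul {n b : ℕ} (hn : n ≠ 0) (hb : Nat.log 2 n < 2 * b) :
    Real.log n ≤ 2 * b := by
  have hle : n ≤ 2 ^ (2 * b) :=
    (Nat.lt_pow_succ_log_self one_lt_two n).le.trans (Nat.pow_le_pow_right two_pos hb)
  calc Real.log n ≤ Real.log ((2 : ℝ) ^ (2 * b)) :=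
        Real.log_le_log (by positivity) (by exact_mod_cast hle)
    _ = 2 * b * Real.log 2 := by rw [Real.log_pow]; push_cast; ring
    _ ≤ 2 * b := mul_le_of_le_one_right (by positivity) (Real.log_two_lt_d9.le.trans (by norm_num))

theorem blockBound_le {n : ℕ} (hn : 2 ≤ n) :
    (blockBound n (Nat.log 2 n / 2 + 1) : ℝ) ≤ 56 * ((n : ℝ) ^ 2 / Real.log n) := by
  set b := Nat.log 2 n / 2 + 1
  have hn₀ : n ≠ 0 := by omega
  have hbn : b ≤ n := by
    have := Nat.log_lt_self 2 hn₀
    omega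
  have hbpos : (0 : ℝ) < b := by exact_mod_cast (Nat.log 2 n / 2).succ_pos
  have hinner : 2 * n + 2 ^ b * (2 * (b + 2)) ≤ 14 * n := by
    have : 2 ^ b * (2 * (b + 2)) ≤ 12 * n :=
      two_pow_succ_mul_le hn₀ (Nat.mul_div_le (Nat.log 2 n) 2)
    omega
  have hblocks : ((n / b + 1 : ℕ) : ℝ) ≤ 2 * (n / b) := by
    have hdiv : ((n / b : ℕ) : ℝ) ≤ n / b := Nat.cast_div_le
    have hone : (1 : ℝ) ≤ n / b := (one_le_div₀ hbpos).2 (by exact_mod_cast hbn)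
    push_cast
    linarith
  have hlog : 0 < Real.log n := Real.log_pos (by exact_mod_cast hn)
  have hinv : (n : ℝ) / b ≤ n * 2 / Real.log n := by
    rw [div_le_div_iff₀ hbpos hlog, mul_assoc]
    exact mul_le_mul_of_nonneg_left (log_le_two_mul hn₀ (by omega)) n.cast_nonneg
  calc (blockBound n b : ℝ) ≤ ((n / b + 1 : ℕ) : ℝ) * (14 * n) := by
        rw [blockBound, Nat.cast_mul]
        gcongr
        exact_mod_cast hinner
    _ ≤ 2 * (n * 2 / Real.log n) * (14 * n) := by
        gcongr
        linarith
    _ = 56 * (n ^ 2 / Real.log n) := by ring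

end Bound

end RubiksCube

theorem mainTheorem3 :
    ∃ C : ℝ, 0 < C ∧ ∀ n : ℕ, 2 ≤ n →
      ∀ c : RubiksCube.Configuration n, c.IsReachable →
        ∃ l : List (RubiksCube.Move n),
          (l.length : ℝ) ≤ C * ((n : ℝ) ^ 2 / Real.log n) ∧ (c.moves l).IsSolved := by
  obtain ⟨K, hK⟩ := RubiksCube.exists_mem_moveSet_pow_face_eq
  refine ⟨K * 56 + 1, by positivity, fun n hn c hc => ?_⟩
  have : NeZero n := ⟨by omega⟩
  obtain ⟨l, hl, hsolved⟩ := hc.exists_moves_isSolved (hK n (Nat.log 2 n / 2 + 1) (Nat.succ_pos _))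
  refine ⟨l, ?_, hsolved⟩
  have hpos : 0 ≤ (n : ℝ) ^ 2 / Real.log n := by positivity
  calc (l.length : ℝ) ≤ K * RubiksCube.blockBound n (Nat.log 2 n / 2 + 1) := by exact_mod_cast hl
    _ ≤ K * (56 * (n ^ 2 / Real.log n)) := by gcongr; exact RubiksCube.blockBound_le hn
    _ ≤ (K * 56 + 1) * (n ^ 2 / Real.log n) := by linarith
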